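/- Let $\alpha_1,\dots,\alpha_N\in\mathbb Z^n$ be nonzero integral vectors with nonnegative coordinates. Write $$\Lambda_{\mathbb Q\ge 0}(\alpha_1,\dots,\alpha_N)=\{a_1\alpha_1+\dots+a_N\alpha_N : a_i\in\mathbb Q,\ a_i\ge 0\}\subset\mathbb Q^n ,$$ and for $\gamma\in\mathbb C^n$ let $P_{\alpha_1,\dots,\alpha_N}(\gamma)$ be the number of tuples $(k_1,\dots,k_N)$ of nonnegative integers with $k_1\alpha_1+\dots+k_N\alpha_N=\gamma$ (the vector partition function; it vanishes outside $\mathbb Z^n$). For an integer $m\times n$ matrix $M$, $c\in\mathbb Z^m$ and an integer $d>0$, the basic quasinumber $\tau_{M,c,d}:\mathbb C^n\to\mathbb Q$ takes the value $1$ at $\gamma$ if $\gamma\in\mathbb Z^n$ and $M\gamma\equiv c\pmod d$, and the value $0$ otherwise. The ring of quasinumbers is the $\mathbb Q$-algebra of functions on $\mathbb C^n$ generated by all $\tau_{M,c,d}$, and the ring of quasipolynomials is the $\mathbb Q$-algebra of functions $\mathbb C^n\to\mathbb C$ generated by the quasinumbers and the coordinate functions $\gamma\mapsto\gamma^1,\dots,\gamma\mapsto\gamma^n$.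 Then there are finitely many sets $C_1,\dots,C_M\subset\mathbb Q^n$, each given by finitely many homogeneous non-strict rational linear inequalities, and quasipolynomials $q_1,\dots,q_M$ such that: 1. each $C_j$ is of full dimension in the $\mathbb Q$-linear span of $\alpha_1,\dots,\alpha_N$, that is, $C_j$ spans the same subspace of $\mathbb Q^n$ as $\alpha_1,\dots,\alpha_N$; in particular, if $\alpha_1,\dots,\alpha_N$ span $\mathbb Q^n$, then each $C_j$ is a closed pointed polyhedral cone of non-zero $n$-volume (its closure in $\mathbb R^n$ has positive Lebesgue measure); 2. $\bigcup_{j=1}^M C_j=\Lambda_{\mathbb Q\ge 0}(\alpha_1,\dots,\alpha_N)$; 3. for each $j$, $P_{\alpha_1,\dots,\alpha_N}(\gamma)=q_j(\gamma)$ for all $\gamma$ in the whole closed cone $C_j$, including its boundary; 4. in particular, $q_i(\gamma)=q_j(\gamma)$ for all $i,j$ and all $\gamma\in C_i\cap C_j$. -/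

import Mathlib

noncomputable section

/-- The cone `Λ_{ℚ≥0}(α₁, …, α_N)`: all combinations of the `αᵢ` with nonnegative rational
coefficients, as a subset of `ℚⁿ`. -/
def rationalCone {n N : ℕ} (α : Fin N → Fin n → ℤ) : Set (Fin n → ℚ) :=
  {γ | ∃ a : Fin N → ℚ, (∀ i, 0 ≤ a i) ∧ ∀ l, γ l = ∑ i, a i * (α i l : ℚ)}

/-- The vector partition function `P_{α₁, …, α_N} : ℂⁿ → ℤ`: the number of ways to write `γ` as
`k₁ α₁ + ⋯ + k_N α_N` with nonnegative integers `kᵢ` (so it is `0` off `ℤⁿ`). -/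
def vectorPartition {n N : ℕ} (α : Fin N → Fin n → ℤ) (γ : Fin n → ℂ) : ℤ :=
  (Set.ncard {k : Fin N → ℕ | ∀ l, ∑ i, (k i : ℂ) * (α i l : ℂ) = γ l} : ℤ)

/-- For nonzero vectors with nonnegative coordinates, the set counted by `vectorPartition` is
finite. -/
theorem vectorPartition_finite {n N : ℕ} (α : Fin N → Fin n → ℤ) (hnonneg : ∀ i l, 0 ≤ α i l)
    (hne : ∀ i, α i ≠ 0) (γ : Fin n → ℂ) :
    {k : Fin N → ℕ | ∀ l, ∑ i, (k i : ℂ) * (α i l : ℂ) = γ l}.Finite := by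
  rcases Set.eq_empty_or_nonempty
    {k : Fin N → ℕ | ∀ l, ∑ i, (k i : ℂ) * (α i l : ℂ) = γ l} with h | ⟨k₀, hk₀⟩
  · rw [h]; exact Set.finite_empty
  · have hl : ∀ i, ∃ l, 1 ≤ α i l := by
      intro i
      obtain ⟨l, hl⟩ := Function.ne_iff.mp (hne i)
      have h1 := hnonneg i l
      exact ⟨l, by simp only [Pi.zero_apply] at hl; omega⟩
    choose l hl using hl
    refine (Set.finite_Iic (fun i => (∑ j, (k₀ j : ℤ) * α j (l i)).toNat)).subset ?_
    intro k hk i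
    have h1 : ∑ j, (k j : ℤ) * α j (l i) = ∑ j, (k₀ j : ℤ) * α j (l i) := by
      have h2 := (hk (l i)).trans (hk₀ (l i)).symm
      exact_mod_cast h2
    have h3 : (k i : ℤ) * α i (l i) ≤ ∑ j, (k j : ℤ) * α j (l i) :=
      Finset.single_le_sum (f := fun j => (k j : ℤ) * α j (l i))
        (fun j _ => mul_nonneg (Int.natCast_nonneg _) (hnonneg _ _)) (Finset.mem_univ i)
    have h4 : (k i : ℤ) ≤ (k i : ℤ) * α i (l i) :=
      le_mul_of_one_le_right (Int.natCast_nonneg _) (hl i)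
    show k i ≤ (∑ j, (k₀ j : ℤ) * α j (l i)).toNat
    omega

open Classical in
/-- The basic quasinumber `τ_{M,c,d} : ℂⁿ → ℚ`: it is `1` at `γ` if all coordinates of `γ` are
integers and `Mγ ≡ c (mod d)` componentwise, and `0` otherwise. -/
def basicQuasinumber {m n : ℕ} (M : Matrix (Fin m) (Fin n) ℤ) (c : Fin m → ℤ) (d : ℕ)
    (γ : Fin n → ℂ) : ℚ :=
  if ∃ z : Fin n → ℤ, (∀ l, γ l = (z l : ℂ)) ∧ ∀ r, M.mulVec z r ≡ c r [ZMOD (d : ℤ)]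
  then 1 else 0

/-- The ring of quasinumbers: the `ℚ`-algebra of functions `ℂⁿ → ℚ` generated by the basic
quasinumbers `τ_{M,c,d}`, where `M` may have any number of rows and `d` is positive. -/
def quasinumbers (n : ℕ) : Subalgebra ℚ ((Fin n → ℂ) → ℚ) :=
  Algebra.adjoin ℚ {f | ∃ (m : ℕ) (M : Matrix (Fin m) (Fin n) ℤ) (c : Fin m → ℤ) (d : ℕ),
    0 < d ∧ f = basicQuasinumber M c d}

/-- The ring of quasipolynomials: the `ℚ`-algebra of functions on `ℂⁿ` generated by the
quasinumbers and the coordinate functions. (The coordinate functions are complex valued,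
hence so are the elements of this algebra; they take rational values on `ℚⁿ`.) -/
def quasipolynomials (n : ℕ) : Subalgebra ℚ ((Fin n → ℂ) → ℂ) :=
  Algebra.adjoin ℚ ({f | ∃ τ ∈ quasinumbers n, f = fun γ => ((τ γ : ℚ) : ℂ)} ∪
    {f | ∃ l : Fin n, f = fun γ => γ l})

/-- A subset of `ℚⁿ` given by finitely many homogeneous non-strict rational linear
inequalities. -/
def IsClosedPolyhedralCone {n : ℕ} (C : Set (Fin n → ℚ)) : Prop :=
  ∃ (s : ℕ) (A : Matrix (Fin s) (Fin n) ℚ), C = {γ | ∀ r, 0 ≤ A.mulVec γ r}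

/-- A subset of `ℚⁿ` has non-zero `n`-volume: its closure in `ℝⁿ` has positive Lebesgue
measure. (For a cone given by rational inequalities, the closure is the set of real solutions
of the same inequalities.) -/
def HasNonzeroVolume {n : ℕ} (C : Set (Fin n → ℚ)) : Prop :=
  0 < MeasureTheory.volume (closure ((fun (γ : Fin n → ℚ) (l : Fin n) => (γ l : ℝ)) '' C))

/-- A closed pointed polyhedral cone: a subset of `ℚⁿ` of non-zero `n`-volume given by
homogeneous non-strict rational linear inequalities. -/
def IsClosedPointedPolyhedralCone {n : ℕ} (C : Set (Fin n → ℚ)) : Prop :=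
  IsClosedPolyhedralCone C ∧ HasNonzeroVolume C

/-- The `ℚ`-linear span of `α₁, …, α_N` in `ℚⁿ`. -/
def rationalSpan {n N : ℕ} (α : Fin N → Fin n → ℤ) : Submodule ℚ (Fin n → ℚ) :=
  Submodule.span ℚ (Set.range fun (i : Fin N) (l : Fin n) => (α i l : ℚ))

end

/-!
The proof is by induction on the number of vectors, from the recursion
`P_{α₀, α₁, …}(γ) = ∑_{k ≥ 0} P_{α₁, …}(γ - k α₀)` (`partitionCount_succ`). The statement carried
through the induction, `IsPiecewiseQuasi`, is that there is a finite arrangement of rational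
hyperplanes through the origin, containing the inequalities of the cone `Λ` of the `αᵢ`, such that
`P` is quasipolynomial on the lattice points of each closed cell contained in `Λ`, of whatever
dimension.

In the inductive step (`IsPiecewiseQuasi.sum_ray`), the line `k ↦ γ - k α₀` crosses the given
hyperplanes at breakpoints that are rational linear forms in `γ`. The new arrangement consists of
the differences of these forms, together with the old forms that vanish on `α₀`. On a closed cell of
it the breakpoints keep their order, weakly, and between two consecutive ones the line stays in one
closed cell of the old arrangement. There the sum over `k` is a difference of values of an
antidifference, taken at the integer parts of the two breakpoints, and this is again
quasipolynomial (`exists_quasi_sum_Ioc`). The formula `∑_{a < k ≤ b} = F(b) - F(a)` remains true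
when `a = b`. This is why weak inequalities between the breakpoints suffice, and hence why the
quasipolynomials are valid on the whole closed cells, including their boundaries. The condition that
some `k` is admissible is obtained by Fourier–Motzkin elimination (`mem_polyCone_sweptForms_iff`),
so that the cone remains defined by part of the arrangement.

Finally, cells of smaller dimension may be discarded, because finitely many closed cones covering
`Λ` still cover it without those of smaller dimension (`exists_mem_span_eq`). A cone spanning `ℚⁿ`
contains the simplicial cone over a basis, hence has positive volume
(`hasNonzeroVolume_polyCone`).
-/

namespace VectorPartition

/-! ### Quasipolynomial functions on an abelian group -/

/-- A rational function on an abelian group `V` is periodic if it is invariant under translation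
by `d • V` for some positive integer `d`. -/
def IsPeriodic {V : Type*} [AddCommGroup V] (f : V → ℚ) : Prop :=
  ∃ d : ℕ, 0 < d ∧ ∀ x v, f (x + d • v) = f x

/-- The algebra of quasipolynomial functions on an abelian group, generated by the additive
functions and the periodic functions. On `ℤⁿ` these are the restrictions of the elements of
`quasipolynomials n`, see `exists_quasipolynomial_extension`. -/
def quasi (V : Type*) [AddCommGroup V] : Subalgebra ℚ (V → ℚ) :=
  Algebra.adjoin ℚ ({f | ∃ φ : V →+ ℚ, f = φ} ∪ {f | IsPeriodic f})

section
variable {V : Type*} [AddCommGroup V]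

theorem addMonoidHom_mem_quasi (φ : V →+ ℚ) : (fun x => φ x) ∈ quasi V :=
  Algebra.subset_adjoin (Or.inl ⟨φ, rfl⟩)

theorem IsPeriodic.mem_quasi {f : V → ℚ} (hf : IsPeriodic f) : f ∈ quasi V :=
  Algebra.subset_adjoin (Or.inr hf)

theorem const_mem_quasi (c : ℚ) : (fun _ => c) ∈ quasi V :=
  (quasi V).algebraMap_mem c

theorem sum_mem_quasi {ι : Type*} (s : Finset ι) {f : ι → V → ℚ} (hf : ∀ i ∈ s, f i ∈ quasi V) :
    (fun x => ∑ i ∈ s, f i x) ∈ quasi V := by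
  have h := Subalgebra.sum_mem (quasi V) hf
  convert h using 1
  ext x
  simp

theorem quasi_induction {p : (V → ℚ) → Prop} (hφ : ∀ φ : V →+ ℚ, p (fun x => φ x))
    (hper : ∀ f, IsPeriodic f → p f)
    (hadd : ∀ f g, p f → p g → p (f + g)) (hmul : ∀ f g, p f → p g → p (f * g))
    {f : V → ℚ} (hf : f ∈ quasi V) : p f := by
  refine Algebra.adjoin_induction (p := fun f _ => p f) ?_ ?_ ?_ ?_ hf
  · rintro f (⟨φ, rfl⟩ | h)
    · exact hφ φ
    · exact hper f h
  · intro c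
    exact hper _ ⟨1, one_pos, fun _ _ => rfl⟩
  · intro f g _ _ h1 h2
    exact hadd f g h1 h2
  · intro f g _ _ h1 h2
    exact hmul f g h1 h2

theorem eval_mem_quasi (P : Polynomial ℚ) {g : V → ℚ} (hg : g ∈ quasi V) :
    (fun x => P.eval (g x)) ∈ quasi V := by
  induction P using Polynomial.induction_on' with
  | add p q hp hq =>
    simp only [Polynomial.eval_add]
    exact (quasi V).add_mem hp hq
  | monomial e a =>
    simp only [Polynomial.eval_monomial]
    exact (quasi V).mul_mem (const_mem_quasi a) ((quasi V).pow_mem hg e)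

/-- Along an arithmetic progression with step `-α`, a quasipolynomial separates into
quasipolynomials of the base point and of the index. -/
theorem exists_separation {q : V → ℚ} (hq : q ∈ quasi V) (α : V) :
    ∃ (ι : Type) (_ : Fintype ι) (a : ι → V → ℚ) (s : ι → ℤ → ℚ), (∀ i, a i ∈ quasi V) ∧
      (∀ i, s i ∈ quasi ℤ) ∧ ∀ x (k : ℤ), q (x - k • α) = ∑ i, a i x * s i k := by
  revert q
  apply quasi_induction
  · intro φ
    refine ⟨Bool, inferInstance, fun b => if b then fun x => φ x else fun _ => -φ α,
      fun b => if b then fun _ => 1 else fun k => (k : ℚ), ?_, ?_, ?_⟩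
    · rintro (_ | _)
      · exact const_mem_quasi _
      · exact addMonoidHom_mem_quasi φ
    · rintro (_ | _)
      · exact addMonoidHom_mem_quasi (Int.castAddHom ℚ)
      · exact const_mem_quasi _
    · intro x k
      simp [mul_comm]
      ring
  · rintro f ⟨d, hd, hf⟩
    have hf' : ∀ x v (k : ℤ), f (x + k • (d • v)) = f x := by
      intro x v k
      have := hf x (k • v)
      rwa [smul_comm] at this
    refine ⟨Fin d, inferInstance, fun r x => f (x - (r : ℤ) • α),
      fun r k => if k % d = r then 1 else 0, ?_, ?_, ?_⟩
    · intro r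
      refine IsPeriodic.mem_quasi ⟨d, hd, fun x v => ?_⟩
      beta_reduce
      rw [add_sub_right_comm, hf]
    · intro r
      refine IsPeriodic.mem_quasi ⟨d, hd, fun x v => ?_⟩
      simp
    · intro x k
      have hd' : (d : ℤ) ≠ 0 := by exact_mod_cast hd.ne'
      have h0 := Int.emod_nonneg k hd'
      have h1 := Int.emod_lt_of_pos k (by exact_mod_cast hd : (0 : ℤ) < d)
      rw [Finset.sum_eq_single ⟨(k % d).toNat, by omega⟩]
      · have h2 : (((k % d).toNat : ℕ) : ℤ) = k % d := Int.toNat_of_nonneg h0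
        simp only [h2, if_true, mul_one]
        rw [← hf' (x - k • α) α (k / d)]
        congr 1
        have h3 : k • α = (k % d) • α + (k / d) • (d • α) := by
          rw [← natCast_zsmul, smul_smul, ← add_smul, Int.emod_add_ediv_mul]
        rw [h3]
        abel
      · intro b _ hb
        beta_reduce
        rw [if_neg, mul_zero]
        intro h
        apply hb
        ext
        simp [h]
      · simp
  · rintro f g ⟨ι, _, a, s, ha, hs, h⟩ ⟨κ, _, b, t, hb, ht, h'⟩
    refine ⟨ι ⊕ κ, inferInstance, Sum.elim a b, Sum.elim s t, ?_, ?_, ?_⟩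
    · rintro (i | i)
      exacts [ha i, hb i]
    · rintro (i | i)
      exacts [hs i, ht i]
    · intro x k
      simp [h, h']
  · rintro f g ⟨ι, _, a, s, ha, hs, h⟩ ⟨κ, _, b, t, hb, ht, h'⟩
    refine ⟨ι × κ, inferInstance, fun i => a i.1 * b i.2, fun i => s i.1 * t i.2, ?_, ?_, ?_⟩
    · exact fun i => (quasi V).mul_mem (ha _) (hb _)
    · exact fun i => (quasi ℤ).mul_mem (hs _) (ht _)
    · intro x k
      simp only [Pi.mul_apply, h, h', Fintype.sum_prod_type, Finset.sum_mul_sum]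
      refine Finset.sum_congr rfl fun i _ => Finset.sum_congr rfl fun j _ => ?_
      ring

end

/-! ### Summation of quasipolynomials -/

/-- A quasipolynomial on `ℤ` is given by one polynomial on each residue class. -/
theorem exists_polynomial_of_mem_quasi_int {s : ℤ → ℚ} (hs : s ∈ quasi ℤ) :
    ∃ (d : ℕ) (_ : 0 < d) (G : ℤ → Polynomial ℚ), ∀ k : ℤ, s k = (G (k % d)).eval (k : ℚ) := by
  revert s
  apply quasi_induction
  · intro φ
    refine ⟨1, one_pos, fun _ => Polynomial.C (φ 1) * Polynomial.X, fun k => ?_⟩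
    have := map_zsmul φ k 1
    simp only [smul_eq_mul, mul_one, zsmul_eq_mul] at this
    beta_reduce
    rw [Polynomial.eval_mul, Polynomial.eval_C, Polynomial.eval_X, this, mul_comm]
  · rintro f ⟨d, hd, hf⟩
    refine ⟨d, hd, fun r => Polynomial.C (f r), fun k => ?_⟩
    rw [Polynomial.eval_C, ← hf (k % d) (k / d)]
    congr 1
    rw [nsmul_eq_mul, Int.emod_add_mul_ediv]
  · rintro f g ⟨d, hd, F, hF⟩ ⟨e, he, G, hG⟩
    refine ⟨d * e, Nat.mul_pos hd he, fun r => F (r % d) + G (r % e), fun k => ?_⟩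
    beta_reduce
    rw [Int.emod_emod_of_dvd k (Int.natCast_dvd_natCast.mpr (Nat.dvd_mul_right d e)),
      Int.emod_emod_of_dvd k (Int.natCast_dvd_natCast.mpr (Nat.dvd_mul_left e d))]
    simp [hF, hG]
  · rintro f g ⟨d, hd, F, hF⟩ ⟨e, he, G, hG⟩
    refine ⟨d * e, Nat.mul_pos hd he, fun r => F (r % d) * G (r % e), fun k => ?_⟩
    beta_reduce
    rw [Int.emod_emod_of_dvd k (Int.natCast_dvd_natCast.mpr (Nat.dvd_mul_right d e)),
      Int.emod_emod_of_dvd k (Int.natCast_dvd_natCast.mpr (Nat.dvd_mul_left e d))]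
    simp [hF, hG]

theorem exists_polynomial_antidifference {d : ℚ} (hd : d ≠ 0) (P : Polynomial ℚ) :
    ∃ A : Polynomial ℚ, ∀ x, A.eval x - A.eval (x - d) = P.eval x := by
  induction P using Polynomial.induction_on' with
  | add p q hp hq =>
    obtain ⟨A, hA⟩ := hp
    obtain ⟨B, hB⟩ := hq
    refine ⟨A + B, fun x => ?_⟩
    rw [Polynomial.eval_add, Polynomial.eval_add, Polynomial.eval_add, ← hA, ← hB]
    ring
  | monomial e a =>
    -- the Bernoulli polynomial of degree `e + 1`, rescaled to step `d`
    refine ⟨Polynomial.C (a * d ^ e / (e + 1)) *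
      (Polynomial.bernoulli (e + 1)).comp (Polynomial.C d⁻¹ * Polynomial.X + 1), fun x => ?_⟩
    have h := Polynomial.bernoulli_eval_one_add (e + 1) (d⁻¹ * x)
    have h2 : d⁻¹ * (x - d) + 1 = d⁻¹ * x := by field_simp; ring
    have h3 : (e : ℚ) + 1 ≠ 0 := by positivity
    simp only [Polynomial.eval_mul, Polynomial.eval_C, Polynomial.eval_comp, Polynomial.eval_add,
      Polynomial.eval_X, Polynomial.eval_one, Polynomial.eval_monomial, h2]
    rw [add_comm (d⁻¹ * x) 1, h, Nat.add_sub_cancel, mul_pow, inv_pow]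
    push_cast
    field_simp
    ring

theorem exists_antidifference {s : ℤ → ℚ} (hs : s ∈ quasi ℤ) :
    ∃ S ∈ quasi ℤ, ∀ m, S m - S (m - 1) = s m := by
  obtain ⟨d, hd, G, hG⟩ := exists_polynomial_of_mem_quasi_int hs
  have hdZ : (0 : ℤ) < d := by exact_mod_cast hd
  choose A hA using fun P => exists_polynomial_antidifference
    (by exact_mod_cast hd.ne' : (d : ℚ) ≠ 0) P
  -- `m - (m - r) % d` is the largest integer `≤ m` in the residue class of `r`
  refine ⟨fun m => ∑ r ∈ Finset.range d, (A (G r)).eval ((m : ℚ) - ((m - r) % d : ℤ)),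
    sum_mem_quasi _ fun r _ => eval_mem_quasi _ ?_, fun m => ?_⟩
  · refine (quasi ℤ).sub_mem (addMonoidHom_mem_quasi (Int.castAddHom ℚ))
      (IsPeriodic.mem_quasi ⟨d, hd, fun x v => ?_⟩)
    beta_reduce
    rw [nsmul_eq_mul, add_sub_right_comm, Int.add_mul_emod_self_left]
  · have h0 := Int.emod_nonneg m hdZ.ne'
    have h1 := Int.emod_lt_of_pos m hdZ
    have h2 : (((m % d).toNat : ℕ) : ℤ) = m % d := Int.toNat_of_nonneg h0
    rw [← Finset.sum_sub_distrib, Finset.sum_eq_single (m % d).toNat, hG, h2, ← hA (G (m % d))]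
    · have h3 : (m - m % d) % d = 0 := Int.emod_eq_zero_of_dvd (Int.dvd_self_sub_emod)
      have h4 : (m - 1 - m % d) % d = d - 1 := by
        have : m - 1 - m % d = (d - 1) + d * (m / d - 1) := by
          have := Int.mul_ediv_add_emod m d
          linarith
        rw [this, Int.add_mul_emod_self_left, Int.emod_eq_of_lt] <;> omega
      rw [h3, h4]
      push_cast
      ring_nf
    · intro r hr hne
      have hr' := Finset.mem_range.mp hr
      have h5 : (m - r) % d ≠ 0 := by
        intro h
        apply hne
        have h7 : (r : ℤ) % d = m % d := (Int.emod_eq_emod_iff_emod_sub_eq_zero.mpr h).symm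
        rw [Int.emod_eq_of_lt (by omega) (by omega)] at h7
        omega
      have h6 : (m - 1 - r) % d = (m - r) % d - 1 := by
        have h8 := Int.emod_nonneg (m - r) hdZ.ne'
        have h9 := Int.emod_lt_of_pos (m - r) hdZ
        have : m - 1 - r = ((m - r) % d - 1) + d * ((m - r) / d) := by
          have := Int.mul_ediv_add_emod (m - r) d
          linarith
        rw [this, Int.add_mul_emod_self_left, Int.emod_eq_of_lt] <;> omega
      rw [h6, sub_eq_zero]
      push_cast
      congr 1
      ring
    · intro h
      exact absurd (Finset.mem_range.mpr (by omega)) h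

section
variable {V : Type*} [AddCommGroup V]

/-- Integer valued quasipolynomials which are periodic modulo every positive integer. The
example needed is the integer part of a rational linear form. -/
def IsQuasilinear (m : V → ℤ) : Prop :=
  (fun x => (m x : ℚ)) ∈ quasi V ∧
    ∀ d : ℕ, 0 < d → ∃ D : ℕ, 0 < D ∧ ∀ x v, (d : ℤ) ∣ m (x + D • v) - m x

theorem IsQuasilinear.neg_sub_one {m : V → ℤ} (hm : IsQuasilinear m) :
    IsQuasilinear fun x => -m x - 1 := by
  refine ⟨?_, fun d hd => ?_⟩
  · push_cast
    exact (quasi V).sub_mem ((quasi V).neg_mem hm.1) (const_mem_quasi 1)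
  · obtain ⟨D, hD, h⟩ := hm.2 d hd
    refine ⟨D, hD, fun x v => ?_⟩
    obtain ⟨c, hc⟩ := h x v
    refine ⟨-c, ?_⟩
    rw [mul_neg, ← hc]
    ring

theorem comp_mem_quasi {s : ℤ → ℚ} (hs : s ∈ quasi ℤ) {m : V → ℤ} (hm : IsQuasilinear m) :
    (fun x => s (m x)) ∈ quasi V := by
  revert s
  apply quasi_induction
  · intro φ
    have : (fun x => φ (m x)) = fun x => φ 1 * (m x : ℚ) := by
      ext x
      have := map_zsmul φ (m x) 1
      simp only [smul_eq_mul, mul_one, zsmul_eq_mul] at this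
      rw [this, mul_comm]
    rw [this]
    exact (quasi V).mul_mem (const_mem_quasi _) hm.1
  · rintro f ⟨d, hd, hf⟩
    obtain ⟨D, hD, h⟩ := hm.2 d hd
    refine IsPeriodic.mem_quasi ⟨D, hD, fun x v => ?_⟩
    obtain ⟨c, hc⟩ := h x v
    beta_reduce
    rw [← hf (m x) c, nsmul_eq_mul, ← hc]
    congr 1
    ring
  · intro f g hf hg
    exact (quasi V).add_mem hf hg
  · intro f g hf hg
    exact (quasi V).mul_mem hf hg

/-- The sum is `F (m₂ x) - F (m₁ x)` for an antidifference `F` in `k`, also when `m₁ x = m₂ x`. -/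
theorem exists_quasi_sum_Ioc {q : V → ℚ} (hq : q ∈ quasi V) (α : V) {m₁ m₂ : V → ℤ}
    (h₁ : IsQuasilinear m₁) (h₂ : IsQuasilinear m₂) :
    ∃ Q ∈ quasi V, ∀ x, m₁ x ≤ m₂ x →
      ∑ k ∈ Finset.Ioc (m₁ x) (m₂ x), q (x - k • α) = Q x := by
  obtain ⟨ι, _, a, s, ha, hs, h⟩ := exists_separation hq α
  choose S hS hdiff using fun i => exists_antidifference (hs i)
  refine ⟨fun x => ∑ i, a i x * (S i (m₂ x) - S i (m₁ x)), sum_mem_quasi _ fun i _ =>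
    (quasi V).mul_mem (ha i) ((quasi V).sub_mem (comp_mem_quasi (hS i) h₂)
      (comp_mem_quasi (hS i) h₁)), fun x hx => ?_⟩
  simp only [h]
  rw [Finset.sum_comm]
  refine Finset.sum_congr rfl fun i _ => ?_
  rw [← Finset.mul_sum]
  congr 1
  generalize m₂ x = b at hx
  induction b, hx using Int.leInduction with
  | base => simp
  | succ b hb ih =>
    have : Finset.Ioc (m₁ x) (b + 1) = insert (b + 1) (Finset.Ioc (m₁ x) b) := by
      ext j
      simp only [Finset.mem_Ioc, Finset.mem_insert]
      omega
    rw [this, Finset.sum_insert (by simp), ih, ← hdiff i (b + 1)]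
    simp

end

theorem exists_common_denominator {n : ℕ} (φ : (Fin n → ℤ) →+ ℚ) :
    ∃ D : ℕ, 0 < D ∧ ∀ v, ∃ c : ℤ, φ (D • v) = c := by
  refine ⟨∏ l, (φ (Pi.single l 1)).den, Finset.prod_pos fun l _ => Rat.den_pos _, fun v => ?_⟩
  have hv : v = ∑ l, v l • Pi.single (M := fun _ => ℤ) l 1 := by
    ext j
    simp [Finset.sum_apply, Pi.single_apply]
  have key : ∀ l, ∃ c : ℤ, ((∏ j, (φ (Pi.single j 1)).den : ℕ) : ℚ) * φ (Pi.single l 1) = c := by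
    intro l
    refine ⟨(∏ j ∈ Finset.univ.erase l, (φ (Pi.single j 1)).den : ℕ) * (φ (Pi.single l 1)).num, ?_⟩
    rw [← Finset.prod_erase_mul _ _ (Finset.mem_univ l)]
    push_cast
    rw [mul_assoc, Rat.den_mul_eq_num]
  choose c hc using key
  refine ⟨∑ l, v l * c l, ?_⟩
  conv_lhs => rw [hv]
  rw [map_nsmul, map_sum, nsmul_eq_mul, Finset.mul_sum]
  push_cast
  refine Finset.sum_congr rfl fun l _ => ?_
  rw [map_zsmul, zsmul_eq_mul, ← hc]
  push_cast
  ring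

theorem isQuasilinear_floor {n : ℕ} (φ : (Fin n → ℤ) →+ ℚ) :
    IsQuasilinear fun x => ⌊φ x⌋ := by
  obtain ⟨D, hD, h⟩ := exists_common_denominator φ
  have hfl : ∀ (d : ℕ) x v, ∃ c : ℤ, φ (x + (d * D) • v) = φ x + (d * c : ℤ) := by
    intro d x v
    obtain ⟨c, hc⟩ := h v
    refine ⟨c, ?_⟩
    rw [map_add, mul_smul, map_nsmul, hc]
    simp
  refine ⟨?_, fun d hd => ⟨d * D, Nat.mul_pos hd hD, fun x v => ?_⟩⟩
  · have : (fun x => (⌊φ x⌋ : ℚ)) = (fun x => φ x) - fun x => Int.fract (φ x) := by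
      ext x
      simp
    rw [this]
    refine (quasi _).sub_mem (addMonoidHom_mem_quasi φ)
      (IsPeriodic.mem_quasi ⟨D, hD, fun x v => ?_⟩)
    obtain ⟨c, hc⟩ := hfl 1 x v
    rw [one_mul] at hc
    beta_reduce
    rw [hc, Int.fract_add_intCast]
  · obtain ⟨c, hc⟩ := hfl d x v
    refine ⟨c, ?_⟩
    simp only [hc, Int.floor_add_intCast]
    ring

theorem isQuasilinear_ceil_sub_one {n : ℕ} (φ : (Fin n → ℤ) →+ ℚ) :
    IsQuasilinear fun x => ⌈φ x⌉ - 1 := by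
  have := (isQuasilinear_floor (-φ)).neg_sub_one
  simpa [Int.floor_neg] using this

/-! ### Polyhedral cones and cells -/

section
variable {E : Type*} [AddCommGroup E] [Module ℚ E]

/-- The cone of common solutions of the inequalities `0 ≤ h x` for `h ∈ G`. -/
def polyCone (G : Set (Module.Dual ℚ E)) : Set E :=
  {x | ∀ h ∈ G, 0 ≤ h x}

/-- The closed cone defined by those inequalities `0 ≤ h x`, `h ∈ H`, that hold at `x₀`. If
`H = -H`, this is the closed face, having `x₀` in its relative interior, of the arrangement of
the hyperplanes `h = 0`. -/
def cell (H : Set (Module.Dual ℚ E)) (x₀ : E) : Set E :=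
  polyCone {h ∈ H | 0 ≤ h x₀}

theorem mem_cell_self (H : Set (Module.Dual ℚ E)) (x₀ : E) : x₀ ∈ cell H x₀ :=
  fun _ hh => hh.2

theorem polyCone_anti {G H : Set (Module.Dual ℚ E)} (h : G ⊆ H) : polyCone H ⊆ polyCone G :=
  fun _ hx g hg => hx g (h hg)

theorem cell_subset_polyCone {G H : Set (Module.Dual ℚ E)} (hGH : G ⊆ H) {x₀ : E}
    (hx₀ : x₀ ∈ polyCone G) : cell H x₀ ⊆ polyCone G :=
  polyCone_anti fun g hg => ⟨hGH hg, hx₀ g hg⟩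

theorem finite_cells {H : Set (Module.Dual ℚ E)} (hH : H.Finite) :
    (Set.range (cell H)).Finite := by
  refine (hH.finite_subsets.image polyCone).subset ?_
  rintro _ ⟨x, rfl⟩
  exact ⟨_, Set.sep_subset _ _, rfl⟩

theorem apply_sub_smul_nonneg_iff_of_pos {h : Module.Dual ℚ E} {a : E} (ha : 0 < h a) (x : E)
    (k : ℚ) : 0 ≤ h (x - k • a) ↔ k ≤ ((h a)⁻¹ • h) x := by
  rw [map_sub, map_smul, LinearMap.smul_apply, smul_eq_mul, smul_eq_mul, sub_nonneg,
    le_inv_mul_iff₀ ha, mul_comm]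

theorem apply_sub_smul_nonneg_iff_of_neg {h : Module.Dual ℚ E} {a : E} (ha : h a < 0) (x : E)
    (k : ℚ) : 0 ≤ h (x - k • a) ↔ ((h a)⁻¹ • h) x ≤ k := by
  have h2 : h (x - k • a) = h a * (((h a)⁻¹ • h) x - k) := by
    rw [map_sub, map_smul, LinearMap.smul_apply, smul_eq_mul, smul_eq_mul, mul_sub,
      mul_inv_cancel_left₀ ha.ne, mul_comm k]
  rw [h2]
  constructor
  · intro h3
    by_contra! h4
    exact absurd h3 (not_le.mpr (mul_neg_of_neg_of_pos ha (sub_pos.mpr h4)))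
  · intro h3
    exact mul_nonneg_of_nonpos_of_nonpos ha.le (sub_nonpos.mpr h3)

/-- The values `k = h x / h a` at which the line `k ↦ x - k • a` crosses the hyperplanes
`h = 0`, `h ∈ H`, as linear forms in `x`. -/
def breakpoints (H : Set (Module.Dual ℚ E)) (a : E) : Set (Module.Dual ℚ E) :=
  (fun h => (h a)⁻¹ • h) '' H

/-- The forms defining the cone swept out by the rays `x + ℚ≥0 • a`, `x ∈ polyCone G`: the
Fourier–Motzkin elimination of `k` from `x - k • a ∈ polyCone G`, `0 ≤ k`. -/
def sweptForms (G : Set (Module.Dual ℚ E)) (a : E) : Set (Module.Dual ℚ E) :=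
  {h ∈ G | h a = 0} ∪ Set.image2 (fun t t' => t' - t)
    (insert 0 (breakpoints {h ∈ G | h a < 0} a)) (breakpoints {h ∈ G | 0 < h a} a)

/-- The arrangement whose cells control the order of the breakpoints along the lines of
direction `a`. -/
def sweptArrangement (H : Set (Module.Dual ℚ E)) (a : E) : Set (Module.Dual ℚ E) :=
  {h ∈ H | h a = 0} ∪ Set.image2 (fun t t' => t' - t)
    (insert 0 (breakpoints {h ∈ H | h a ≠ 0} a)) (insert 0 (breakpoints {h ∈ H | h a ≠ 0} a))

theorem insert_zero_breakpoints_neg_subset {G H : Set (Module.Dual ℚ E)} (hGH : G ⊆ H) (a : E) :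
    insert 0 (breakpoints {h ∈ G | h a < 0} a) ⊆ insert 0 (breakpoints {h ∈ H | h a ≠ 0} a) :=
  Set.insert_subset_insert (Set.image_mono (s := {h ∈ G | h a < 0}) (t := {h ∈ H | h a ≠ 0})
    fun _ hh => ⟨hGH hh.1, hh.2.ne⟩)

theorem breakpoints_pos_subset {G H : Set (Module.Dual ℚ E)} (hGH : G ⊆ H) (a : E) :
    breakpoints {h ∈ G | 0 < h a} a ⊆ insert 0 (breakpoints {h ∈ H | h a ≠ 0} a) :=
  (Set.image_mono (s := {h ∈ G | 0 < h a}) (t := {h ∈ H | h a ≠ 0})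
    fun _ hh => ⟨hGH hh.1, hh.2.ne'⟩).trans (Set.subset_insert _ _)

theorem finite_sweptArrangement {H : Set (Module.Dual ℚ E)} (hH : H.Finite) (a : E) :
    (sweptArrangement H a).Finite := by
  have h1 : (insert 0 (breakpoints {h ∈ H | h a ≠ 0} a)).Finite :=
    ((hH.subset (Set.sep_subset _ _)).image _).insert 0
  exact (hH.subset (Set.sep_subset _ _)).union (h1.image2 _ h1)

theorem sweptForms_subset {G H : Set (Module.Dual ℚ E)} (hGH : G ⊆ H) (a : E) :
    sweptForms G a ⊆ sweptArrangement H a := by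
  exact Set.union_subset_union (fun h hh => ⟨hGH hh.1, hh.2⟩) (Set.image2_subset
    (insert_zero_breakpoints_neg_subset hGH a) (breakpoints_pos_subset hGH a))

theorem sub_smul_mem_polyCone_iff (G : Set (Module.Dual ℚ E)) (a x : E) (k : ℚ) :
    (0 ≤ k ∧ x - k • a ∈ polyCone G) ↔ (∀ h ∈ G, h a = 0 → 0 ≤ h x) ∧
      (∀ t ∈ insert 0 (breakpoints {h ∈ G | h a < 0} a), t x ≤ k) ∧
      ∀ t ∈ breakpoints {h ∈ G | 0 < h a} a, k ≤ t x := by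
  constructor
  · rintro ⟨hk, hx⟩
    refine ⟨fun h hG h0 => ?_, ?_, ?_⟩
    · simpa [h0] using hx h hG
    · rintro t (rfl | ⟨h, ⟨hG, h0⟩, rfl⟩)
      · simpa using hk
      · exact (apply_sub_smul_nonneg_iff_of_neg h0 x k).mp (hx h hG)
    · rintro t ⟨h, ⟨hG, h0⟩, rfl⟩
      exact (apply_sub_smul_nonneg_iff_of_pos h0 x k).mp (hx h hG)
  · rintro ⟨h1, h2, h3⟩
    refine ⟨by simpa using h2 0 (Set.mem_insert _ _), fun h hG => ?_⟩
    rcases lt_trichotomy (h a) 0 with h0 | h0 | h0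
    · exact (apply_sub_smul_nonneg_iff_of_neg h0 x k).mpr
        (h2 _ (Set.mem_insert_of_mem _ ⟨h, ⟨hG, h0⟩, rfl⟩))
    · simpa [h0] using h1 h hG h0
    · exact (apply_sub_smul_nonneg_iff_of_pos h0 x k).mpr (h3 _ ⟨h, ⟨hG, h0⟩, rfl⟩)

theorem mem_polyCone_sweptForms_iff {G : Set (Module.Dual ℚ E)} (hG : G.Finite) (a x : E) :
    x ∈ polyCone (sweptForms G a) ↔ ∃ k : ℚ, 0 ≤ k ∧ x - k • a ∈ polyCone G := by
  simp only [sub_smul_mem_polyCone_iff]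
  constructor
  · intro hx
    obtain ⟨l, hl, hmax⟩ := Set.exists_max_image (insert 0 (breakpoints {h ∈ G | h a < 0} a))
      (fun t => t x) (((hG.subset (Set.sep_subset _ _)).image _).insert 0) (Set.insert_nonempty _ _)
    refine ⟨l x, fun h hh h0 => hx h (Or.inl ⟨hh, h0⟩), hmax, fun t ht => ?_⟩
    have := hx (t - l) (Or.inr ⟨l, hl, t, ht, rfl⟩)
    simpa using this
  · rintro ⟨k, h1, h2, h3⟩ h (⟨hh, h0⟩ | ⟨t, ht, t', ht', rfl⟩)
    · exact h1 h hh h0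
    · have := (h2 t ht).trans (h3 t' ht')
      simpa using this

/-- On a cell of `sweptArrangement H a`, translation by `-k • a` leads into one fixed cell of
`H`, as long as `k` has a fixed position relative to the breakpoints. -/
theorem sub_smul_mem_cell {H : Set (Module.Dual ℚ E)} {a x₀ x : E} {k₀ k : ℚ}
    (hx : x ∈ cell (sweptArrangement H a) x₀)
    (hk : ∀ t ∈ insert 0 (breakpoints {h ∈ H | h a ≠ 0} a),
      (k₀ ≤ t x₀ → k ≤ t x) ∧ (t x₀ ≤ k₀ → t x ≤ k)) :
    x - k • a ∈ cell H (x₀ - k₀ • a) := by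
  rintro h ⟨hH, h0⟩
  have hT (hne : h a ≠ 0) := hk _ (Set.mem_insert_of_mem _ ⟨h, ⟨hH, hne⟩, rfl⟩)
  rcases lt_trichotomy (h a) 0 with ha | ha | ha
  · rw [apply_sub_smul_nonneg_iff_of_neg ha] at h0 ⊢
    exact (hT ha.ne).2 h0
  · simp only [map_sub, map_smul, ha, smul_zero, sub_zero] at h0 ⊢
    exact hx h ⟨Or.inl ⟨hH, ha⟩, h0⟩
  · rw [apply_sub_smul_nonneg_iff_of_pos ha] at h0 ⊢
    exact (hT ha.ne').1 h0

theorem breakpoint_le_of_mem_cell {H : Set (Module.Dual ℚ E)} {a x₀ x : E}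
    (hx : x ∈ cell (sweptArrangement H a) x₀) {t t' : Module.Dual ℚ E}
    (ht : t ∈ insert 0 (breakpoints {h ∈ H | h a ≠ 0} a))
    (ht' : t' ∈ insert 0 (breakpoints {h ∈ H | h a ≠ 0} a)) (h : t x₀ ≤ t' x₀) : t x ≤ t' x := by
  have := hx (t' - t) ⟨Or.inr ⟨t, ht, t', ht', rfl⟩, by simpa using h⟩
  simpa using this

end

/-! ### Piecewise quasipolynomial functions -/

/-- The inclusion of `ℤⁿ` into `ℚⁿ`. -/
def toRat (n : ℕ) : (Fin n → ℤ) →+ (Fin n → ℚ) :=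
  (Int.castAddHom ℚ).compLeft (Fin n)

@[simp]
theorem toRat_apply {n : ℕ} (z : Fin n → ℤ) (l : Fin n) : toRat n z l = z l := rfl

/-- The cone `Λ` is given by part of a finite arrangement `H`, and `f` is quasipolynomial on the
lattice points of every closed cell of `H` contained in `Λ`. -/
def IsPiecewiseQuasi {n : ℕ} (f : (Fin n → ℤ) → ℚ) (Λ : Set (Fin n → ℚ)) : Prop :=
  ∃ H : Set (Module.Dual ℚ (Fin n → ℚ)), H.Finite ∧ (∃ G ⊆ H, Λ = polyCone G) ∧
    ∀ x₀ ∈ Λ, ∃ q ∈ quasi (Fin n → ℤ), ∀ z, toRat n z ∈ cell H x₀ → f z = q z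

theorem ceil_sub_one_le_floor {x y : ℚ} (h : x ≤ y) : ⌈x⌉ - 1 ≤ ⌊y⌋ := by
  rw [Int.le_floor]
  push_cast
  linarith [Int.ceil_lt_add_one x]

theorem sum_Ioc_add_sum_Ioc {M : Type*} [AddCommMonoid M] (f : ℤ → M) {a b c : ℤ} (hab : a ≤ b)
    (hbc : b ≤ c) :
    ∑ k ∈ Finset.Ioc a b, f k + ∑ k ∈ Finset.Ioc b c, f k = ∑ k ∈ Finset.Ioc a c, f k := by
  rw [← Finset.Ioc_union_Ioc_eq_Ioc hab hbc, Finset.sum_union]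
  rw [Finset.disjoint_left]
  intro k
  simp only [Finset.mem_Ioc]
  omega

/-- If `k ↦ f (z - k • α)` agrees with one quasipolynomial between two quasilinear bounds, then its
sum over that range is quasipolynomial in `z`. Since only `m₁ z ≤ m₂ z` is required, the range may
be empty for some `z ∈ S`. -/
theorem exists_quasi_segment_sum {n : ℕ} {f : (Fin n → ℤ) → ℚ} {S : Set (Fin n → ℤ)}
    {q : (Fin n → ℤ) → ℚ} (hq : q ∈ quasi (Fin n → ℤ)) (α : Fin n → ℤ)
    {m₁ m₂ : (Fin n → ℤ) → ℤ} (h₁ : IsQuasilinear m₁) (h₂ : IsQuasilinear m₂)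
    (hle : ∀ z ∈ S, m₁ z ≤ m₂ z)
    (hf : ∀ z ∈ S, ∀ k ∈ Finset.Ioc (m₁ z) (m₂ z), f (z - k • α) = q (z - k • α)) :
    ∃ Q ∈ quasi (Fin n → ℤ), ∀ z ∈ S, ∑ k ∈ Finset.Ioc (m₁ z) (m₂ z), f (z - k • α) = Q z := by
  obtain ⟨Q, hQ, h⟩ := exists_quasi_sum_Ioc hq α h₁ h₂
  exact ⟨Q, hQ, fun z hz => (Finset.sum_congr rfl (hf z hz)).trans (h z (hle z hz))⟩

/-- Summation along the rays of direction `-α` preserves piecewise quasipolynomiality. On a cell of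
`sweptArrangement H α` the breakpoints keep their weak order, so the summation range splits into
segments with endpoints linear in `z`, each mapped into a single cell of `H`. The assumption on
`-α` makes the range finite, and that on `f'` says that `f' z` is the sum of `f (z - k • α)` over
all `0 ≤ k`, computed on any finite set containing the relevant `k`. -/
theorem IsPiecewiseQuasi.sum_ray {n : ℕ} {f : (Fin n → ℤ) → ℚ} {Λ : Set (Fin n → ℚ)}
    (hf : IsPiecewiseQuasi f Λ) (α : Fin n → ℤ) (hα : -toRat n α ∉ Λ) {f' : (Fin n → ℤ) → ℚ}
    (hf' : ∀ (z : Fin n → ℤ) (s : Finset ℤ), (∀ k ∈ s, 0 ≤ k) →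
      (∀ k : ℤ, 0 ≤ k → toRat n z - (k : ℚ) • toRat n α ∈ Λ → k ∈ s) →
      f' z = ∑ k ∈ s, f (z - k • α)) :
    IsPiecewiseQuasi f' {x | ∃ k : ℚ, 0 ≤ k ∧ x - k • toRat n α ∈ Λ} := by
  obtain ⟨H, hH, ⟨G, hGH, rfl⟩, hq⟩ := hf
  set a := toRat n α
  have hGfin := hH.subset hGH
  have hΛ : {x | ∃ k : ℚ, 0 ≤ k ∧ x - k • a ∈ polyCone G} = polyCone (sweptForms G a) := by
    ext x
    exact (mem_polyCone_sweptForms_iff hGfin a x).symm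
  refine ⟨sweptArrangement H a, finite_sweptArrangement hH a,
    ⟨sweptForms G a, sweptForms_subset hGH a, hΛ⟩, fun x₀ hx₀ => ?_⟩
  set L := insert 0 (breakpoints {h ∈ G | h a < 0} a)
  set U := breakpoints {h ∈ G | 0 < h a} a
  set T := insert 0 (breakpoints {h ∈ H | h a ≠ 0} a)
  have hLT : L ⊆ T := insert_zero_breakpoints_neg_subset hGH a
  have hUT : U ⊆ T := breakpoints_pos_subset hGH a
  have hTfin : T.Finite := ((hH.subset (Set.sep_subset _ _)).image _).insert 0
  have hUne : U.Nonempty := by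
    have : ∃ h ∈ G, ¬ 0 ≤ h (-a) := by simpa [polyCone] using hα
    obtain ⟨h, hh, hneg⟩ := this
    exact ⟨_, h, ⟨hh, by simpa using hneg⟩, rfl⟩
  obtain ⟨l, hlL, hlmax⟩ := Set.exists_max_image L (fun t => t x₀) (hTfin.subset hLT)
    (Set.insert_nonempty _ _)
  obtain ⟨u, huU, humin⟩ := Set.exists_min_image U (fun t => t x₀) (hTfin.subset hUT) hUne
  obtain ⟨hx0, hlu⟩ : (∀ h ∈ G, h a = 0 → 0 ≤ h x₀) ∧ l x₀ ≤ u x₀ := by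
    obtain ⟨k, hk⟩ := hx₀
    obtain ⟨h1, h2, h3⟩ := (sub_smul_mem_polyCone_iff G a x₀ k).mp hk
    exact ⟨h1, (h2 l hlL).trans (h3 u huU)⟩
  have hmono : ∀ z, toRat n z ∈ cell (sweptArrangement H a) x₀ → ∀ t ∈ T, ∀ t' ∈ T,
      t x₀ ≤ t' x₀ → t (toRat n z) ≤ t' (toRat n z) :=
    fun z hz t ht t' ht' h => breakpoint_le_of_mem_cell hz ht ht' h
  let form (t : Module.Dual ℚ (Fin n → ℚ)) : (Fin n → ℤ) →+ ℚ := t.toAddMonoidHom.comp (toRat n)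
  -- one quasipolynomial for all translates whose position among the breakpoints is that of `k₀`
  have hseg : ∀ k₀ : ℚ, l x₀ ≤ k₀ → k₀ ≤ u x₀ → ∃ q ∈ quasi (Fin n → ℤ), ∀ z,
      toRat n z ∈ cell (sweptArrangement H a) x₀ → ∀ k : ℤ,
      (∀ t ∈ T, (k₀ ≤ t x₀ → (k : ℚ) ≤ t (toRat n z)) ∧ (t x₀ ≤ k₀ → t (toRat n z) ≤ k)) →
      f (z - k • α) = q (z - k • α) := by
    intro k₀ h1 h2
    obtain ⟨q, hqq, hfq⟩ := hq (x₀ - k₀ • a) ((sub_smul_mem_polyCone_iff G a x₀ k₀).mpr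
      ⟨hx0, fun t ht => (hlmax t ht).trans h1, fun t ht => h2.trans (humin t ht)⟩).2
    refine ⟨q, hqq, fun z hz k hk => hfq _ ?_⟩
    rw [map_sub, map_zsmul, ← Int.cast_smul_eq_zsmul ℚ]
    exact sub_smul_mem_cell hz hk
  -- the sum from the lowest admissible `k` up to a breakpoint `t`, by induction on the number of
  -- breakpoints below `t` at `x₀`
  have chain : ∀ N : ℕ, ∀ t ∈ T, Set.ncard {t' ∈ T | t' x₀ < t x₀} = N → l x₀ ≤ t x₀ →
      t x₀ ≤ u x₀ → ∃ q ∈ quasi (Fin n → ℤ), ∀ z ∈ {z | toRat n z ∈ cell (sweptArrangement H a) x₀},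
      ∑ k ∈ Finset.Ioc (⌈form l z⌉ - 1) ⌊form t z⌋, f (z - k • α) = q z := by
    intro N
    induction N using Nat.strong_induction_on with
    | _ N ih =>
    intro t ht hN hlt htu
    rcases hlt.eq_or_lt with heq | hlt
    · obtain ⟨q, hqq, hfq⟩ := hseg (l x₀) le_rfl hlu
      refine exists_quasi_segment_sum hqq α (isQuasilinear_ceil_sub_one (form l))
        (isQuasilinear_floor (form t))
        (fun z hz => ceil_sub_one_le_floor (hmono z hz l (hLT hlL) t ht heq.le))
        (fun z hz k hk => hfq z hz k ?_)
      rw [Finset.mem_Ioc, Int.sub_one_lt_iff, Int.ceil_le, Int.le_floor] at hk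
      have h1 : form t z ≤ form l z := hmono z hz t ht l (hLT hlL) heq.ge
      exact fun t' ht' => ⟨fun h => (hk.2.trans h1).trans (hmono z hz l (hLT hlL) t' ht' h),
        fun h => (hmono z hz t' ht' l (hLT hlL) h).trans hk.1⟩
    · obtain ⟨p, ⟨hpT, hpt⟩, hpmax⟩ := Set.exists_max_image {t' ∈ T | t' x₀ < t x₀} (fun t => t x₀)
        (hTfin.subset (Set.sep_subset _ _)) ⟨l, hLT hlL, hlt⟩
      have hlp : l x₀ ≤ p x₀ := hpmax l ⟨hLT hlL, hlt⟩
      obtain ⟨q₁, hq₁, hsum₁⟩ := ih (Set.ncard {t' ∈ T | t' x₀ < p x₀}) (by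
        rw [← hN]
        refine Set.ncard_lt_ncard ?_ (hTfin.subset (Set.sep_subset _ _))
        refine Set.ssubset_iff_exists.mpr ⟨fun t' h' => ⟨h'.1, h'.2.trans hpt⟩, p, ⟨hpT, hpt⟩, ?_⟩
        exact fun h => lt_irrefl _ h.2) p hpT rfl hlp (hpt.le.trans htu)
      -- between the consecutive breakpoints `p` and `t` any intermediate position will do
      obtain ⟨q, hqq, hfq⟩ := hseg ((p x₀ + t x₀) / 2) (by linarith) (by linarith)
      obtain ⟨q₂, hq₂, hsum₂⟩ := exists_quasi_segment_sum
        (S := {z | toRat n z ∈ cell (sweptArrangement H a) x₀}) hqq α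
        (isQuasilinear_floor (form p)) (isQuasilinear_floor (form t))
        (fun z hz => Int.floor_mono (hmono z hz p hpT t ht hpt.le)) (fun z hz k hk => hfq z hz k (by
          rw [Finset.mem_Ioc, Int.floor_lt, Int.le_floor] at hk
          intro t' ht'
          constructor
          · intro h
            refine hk.2.trans (hmono z hz t ht t' ht' ?_)
            by_contra! h'
            have := hpmax t' ⟨ht', h'⟩
            linarith
          · intro h
            exact (hmono z hz t' ht' p hpT (hpmax t' ⟨ht', by linarith⟩)).trans hk.1.le))
      refine ⟨q₁ + q₂, (quasi _).add_mem hq₁ hq₂, fun z hz => ?_⟩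
      rw [Pi.add_apply, ← hsum₁ z hz, ← hsum₂ z hz]
      exact (sum_Ioc_add_sum_Ioc _ (ceil_sub_one_le_floor (hmono z hz l (hLT hlL) p hpT hlp))
        (Int.floor_mono (hmono z hz p hpT t ht hpt.le))).symm
  obtain ⟨q, hqq, hsum⟩ := chain _ u (hUT huU) rfl hlu le_rfl
  refine ⟨q, hqq, fun z hz => ?_⟩
  rw [← hsum z hz]
  apply hf'
  · intro k hk
    rw [Finset.mem_Ioc, Int.sub_one_lt_iff, Int.ceil_le] at hk
    have h0 : (0 : ℚ) ≤ form l z :=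
      hmono z hz 0 (Set.mem_insert _ _) l (hLT hlL) (hlmax 0 (Set.mem_insert _ _))
    exact_mod_cast h0.trans hk.1
  · intro k hk hmem
    obtain ⟨-, h2, h3⟩ := (sub_smul_mem_polyCone_iff G a _ k).mp ⟨by exact_mod_cast hk, hmem⟩
    rw [Finset.mem_Ioc, Int.sub_one_lt_iff, Int.ceil_le, Int.le_floor]
    exact ⟨h2 l hlL, h3 u huU⟩

/-! ### The recursion for the vector partition function -/

/-- The vector partition function on `ℤⁿ`, with values in `ℚ`. -/
noncomputable def partitionCount {n N : ℕ} (α : Fin N → Fin n → ℤ) (z : Fin n → ℤ) : ℚ :=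
  (Set.ncard {k : Fin N → ℕ | ∑ i, (k i : ℤ) • α i = z} : ℚ)

theorem sum_smul_eq_iff {n N : ℕ} (α : Fin N → Fin n → ℤ) (k : Fin N → ℕ) (z : Fin n → ℤ) :
    ∑ i, (k i : ℤ) • α i = z ↔ ∀ l, ∑ i, (k i : ℂ) * (α i l : ℂ) = (z l : ℂ) := by
  rw [funext_iff]
  refine forall_congr' fun l => ?_
  simp only [Finset.sum_apply, Pi.smul_apply, smul_eq_mul]
  rw [← Int.cast_inj (α := ℂ)]
  push_cast
  rfl

theorem vectorPartition_intCast {n N : ℕ} (α : Fin N → Fin n → ℤ) (z : Fin n → ℤ) :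
    (vectorPartition α (fun l => (z l : ℂ)) : ℂ) = partitionCount α z := by
  simp only [vectorPartition, partitionCount, sum_smul_eq_iff]
  push_cast
  rfl

theorem vectorPartition_eq_zero {n N : ℕ} (α : Fin N → Fin n → ℤ) {γ : Fin n → ℂ}
    (hγ : ¬ ∃ z : Fin n → ℤ, ∀ l, γ l = z l) : vectorPartition α γ = 0 := by
  have : {k : Fin N → ℕ | ∀ l, ∑ i, (k i : ℂ) * (α i l : ℂ) = γ l} = ∅ := by
    refine Set.eq_empty_of_forall_notMem fun k hk => hγ ⟨fun l => ∑ i, (k i : ℤ) * α i l, ?_⟩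
    intro l
    rw [← hk l]
    push_cast
    rfl
  rw [vectorPartition, this]
  simp

theorem finite_partitions {n N : ℕ} {α : Fin N → Fin n → ℤ} (hnonneg : ∀ i l, 0 ≤ α i l)
    (hne : ∀ i, α i ≠ 0) (z : Fin n → ℤ) :
    {k : Fin N → ℕ | ∑ i, (k i : ℤ) • α i = z}.Finite := by
  simp only [sum_smul_eq_iff]
  exact vectorPartition_finite α hnonneg hne _

theorem partitionCount_succ {n N : ℕ} {α : Fin (N + 1) → Fin n → ℤ}
    (hnonneg : ∀ i l, 0 ≤ α i l) (hne : ∀ i, α i ≠ 0) (z : Fin n → ℤ) (s : Finset ℤ)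
    (hs : ∀ k ∈ s, 0 ≤ k)
    (hs' : ∀ (k : ℤ) (k' : Fin N → ℕ), 0 ≤ k → ∑ i, (k' i : ℤ) • Fin.tail α i = z - k • α 0 →
      k ∈ s) :
    partitionCount α z = ∑ k ∈ s, partitionCount (Fin.tail α) (z - k • α 0) := by
  have hfin := finite_partitions hnonneg hne z
  rw [partitionCount, Set.ncard_eq_toFinset_card _ hfin,
    Finset.card_eq_sum_card_fiberwise (f := fun k => (k 0 : ℤ)) (t := s)]
  · push_cast
    refine Finset.sum_congr rfl fun k hk => ?_
    rw [partitionCount, ← Set.ncard_coe_finset, Nat.cast_inj]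
    lift k to ℕ using hs k hk
    rw [← Set.ncard_image_of_injective
      {k' : Fin N → ℕ | ∑ i, (k' i : ℤ) • Fin.tail α i = z - (k : ℤ) • α 0}
      (Fin.cons_right_injective (α := fun _ => ℕ) k)]
    refine congrArg Set.ncard (Set.ext fun k' => ?_)
    simp only [Finset.coe_filter, Set.Finite.mem_toFinset, Set.mem_ofPred_eq, Set.mem_image,
      Fin.sum_univ_succ, Nat.cast_inj]
    constructor
    · rintro ⟨h, rfl⟩
      refine ⟨Fin.tail k', ?_, Fin.cons_self_tail k'⟩
      rw [← h, add_sub_cancel_left]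
      rfl
    · rintro ⟨k'', h, rfl⟩
      simp only [Fin.cons_zero, Fin.cons_succ, and_true]
      rw [add_comm, ← eq_sub_iff_add_eq, ← h]
      rfl
  · intro k hk
    have hk' : ∑ i, (k i : ℤ) • α i = z := by simpa using hk
    refine hs' (k 0) (Fin.tail k) (Int.natCast_nonneg _) ?_
    rw [← hk', Fin.sum_univ_succ, add_sub_cancel_left]
    rfl

theorem mem_rationalCone_iff {n N : ℕ} (α : Fin N → Fin n → ℤ) (x : Fin n → ℚ) :
    x ∈ rationalCone α ↔ ∃ a : Fin N → ℚ, (∀ i, 0 ≤ a i) ∧ x = ∑ i, a i • toRat n (α i) := by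
  simp only [rationalCone, Set.mem_ofPred_eq, funext_iff, Finset.sum_apply, Pi.smul_apply,
    toRat_apply, smul_eq_mul]

theorem rationalCone_succ {n N : ℕ} (α : Fin (N + 1) → Fin n → ℤ) :
    rationalCone α = {x | ∃ k : ℚ, 0 ≤ k ∧ x - k • toRat n (α 0) ∈ rationalCone (Fin.tail α)} := by
  ext x
  simp only [mem_rationalCone_iff, Set.mem_ofPred_eq, Fin.sum_univ_succ]
  constructor
  · rintro ⟨a, ha, rfl⟩
    exact ⟨a 0, ha 0, Fin.tail a, fun i => ha i.succ, by rw [add_sub_cancel_left]; rfl⟩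
  · rintro ⟨k, hk, a, ha, h⟩
    refine ⟨Fin.cons k a, fun i => Fin.cases hk ha i, ?_⟩
    rw [sub_eq_iff_eq_add'] at h
    exact h

theorem neg_notMem_rationalCone {n N : ℕ} {α : Fin N → Fin n → ℤ} (hnonneg : ∀ i l, 0 ≤ α i l)
    {β : Fin n → ℤ} (hβ : ∀ l, 0 ≤ β l) (hne : β ≠ 0) : -toRat n β ∉ rationalCone α := by
  rintro ⟨a, ha, h⟩
  apply hne
  ext l
  have h1 : (0 : ℚ) ≤ ∑ i, a i * (α i l : ℚ) :=
    Finset.sum_nonneg fun i _ => mul_nonneg (ha i) (by exact_mod_cast hnonneg i l)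
  rw [← h l] at h1
  have h2 : (β l : ℚ) ≤ 0 := by simpa using h1
  exact le_antisymm (by exact_mod_cast h2) (hβ l)

theorem isPiecewiseQuasi_partitionCount_zero {n : ℕ} (α : Fin 0 → Fin n → ℤ) :
    IsPiecewiseQuasi (partitionCount α) (rationalCone α) := by
  let p (l : Fin n) : Module.Dual ℚ (Fin n → ℚ) := LinearMap.proj l
  have hcone : ∀ x : Fin n → ℚ, x ∈ polyCone (Set.range p ∪ Set.range (-p)) → x = 0 := by
    intro x hx
    ext l
    have h1 : 0 ≤ x l := hx (p l) (Or.inl ⟨l, rfl⟩)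
    have h2 : 0 ≤ -x l := hx (-p l) (Or.inr ⟨l, rfl⟩)
    exact le_antisymm (neg_nonneg.mp h2) h1
  refine ⟨Set.range p ∪ Set.range (-p), (Set.finite_range _).union (Set.finite_range _),
    ⟨_, subset_rfl, ?_⟩, fun x₀ hx₀ => ⟨_, const_mem_quasi 1, fun z hz => ?_⟩⟩
  · ext x
    rw [mem_rationalCone_iff]
    constructor
    · rintro ⟨a, -, rfl⟩ h -
      simp
    · intro hx
      exact ⟨0, fun _ => le_rfl, by simp [hcone x hx]⟩
  · have hx0 : x₀ = 0 := by
      obtain ⟨a, -, rfl⟩ := (mem_rationalCone_iff _ _).mp hx₀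
      simp
    subst hx0
    have hz0 := hcone _ (cell_subset_polyCone subset_rfl (fun h _ => by simp) hz)
    have : z = 0 := by
      ext l
      have := congrFun hz0 l
      simpa using this
    simp [partitionCount, this]

theorem isPiecewiseQuasi_partitionCount {n N : ℕ} (α : Fin N → Fin n → ℤ)
    (hnonneg : ∀ i l, 0 ≤ α i l) (hne : ∀ i, α i ≠ 0) :
    IsPiecewiseQuasi (partitionCount α) (rationalCone α) := by
  induction N with
  | zero => exact isPiecewiseQuasi_partitionCount_zero α
  | succ N ih =>
    rw [rationalCone_succ]
    refine (ih (Fin.tail α) (fun i => hnonneg i.succ) (fun i => hne i.succ)).sum_ray (α 0)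
      (neg_notMem_rationalCone (fun i => hnonneg i.succ) (hnonneg 0) (hne 0)) ?_
    intro z s hs hs'
    refine partitionCount_succ hnonneg hne z s hs fun k k' hk h => hs' k hk ?_
    rw [mem_rationalCone_iff]
    refine ⟨fun i => k' i, fun i => Nat.cast_nonneg _, ?_⟩
    rw [Int.cast_smul_eq_zsmul, ← map_zsmul, ← map_sub, ← h, map_sum]
    refine Finset.sum_congr rfl fun i _ => ?_
    rw [map_zsmul, ← Int.cast_smul_eq_zsmul ℚ, Int.cast_natCast]

/-! ### Extension of quasipolynomials from `ℤⁿ` to `ℂⁿ` -/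

theorem basicQuasinumber_mem_quasipolynomials {m n : ℕ} (M : Matrix (Fin m) (Fin n) ℤ)
    (c : Fin m → ℤ) {d : ℕ} (hd : 0 < d) :
    (fun γ => ((basicQuasinumber M c d γ : ℚ) : ℂ)) ∈ quasipolynomials n :=
  Algebra.subset_adjoin (Or.inl ⟨_, Algebra.subset_adjoin ⟨m, M, c, d, hd, rfl⟩, rfl⟩)

open Classical in
theorem basicQuasinumber_one_intCast {n : ℕ} (c : Fin n → ℤ) (d : ℕ) (z : Fin n → ℤ) :
    basicQuasinumber (1 : Matrix (Fin n) (Fin n) ℤ) c d (fun l => (z l : ℂ)) =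
      if ∀ l, z l ≡ c l [ZMOD d] then 1 else 0 := by
  rw [basicQuasinumber]
  refine if_congr ?_ rfl rfl
  simp only [Matrix.one_mulVec, Int.cast_inj]
  constructor
  · rintro ⟨z', h, h'⟩
    obtain rfl : z = z' := funext h
    exact h'
  · exact fun h => ⟨z, fun _ => rfl, h⟩

theorem basicQuasinumber_eq_zero {m n : ℕ} (M : Matrix (Fin m) (Fin n) ℤ)
    (c : Fin m → ℤ) (d : ℕ) {γ : Fin n → ℂ} (hγ : ¬ ∃ z : Fin n → ℤ, ∀ l, γ l = z l) :
    basicQuasinumber M c d γ = 0 :=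
  if_neg fun ⟨z, h, _⟩ => hγ ⟨z, h⟩

theorem exists_quasipolynomial_extension {n : ℕ} {q : (Fin n → ℤ) → ℚ}
    (hq : q ∈ quasi (Fin n → ℤ)) :
    ∃ Q ∈ quasipolynomials n, (∀ z : Fin n → ℤ, Q (fun l => (z l : ℂ)) = q z) ∧
      ∀ γ : Fin n → ℂ, (¬ ∃ z : Fin n → ℤ, ∀ l, γ l = z l) → Q γ = 0 := by
  revert q
  apply quasi_induction
  · intro φ
    -- the factor with modulus `1` is the indicator function of `ℤⁿ`
    refine ⟨fun γ => (basicQuasinumber (1 : Matrix (Fin n) (Fin n) ℤ) 0 1 γ : ℂ) *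
      ∑ l, (φ (Pi.single l 1) : ℂ) * γ l, ?_, fun z => ?_, fun γ hγ => ?_⟩
    · refine (quasipolynomials n).mul_mem
        (basicQuasinumber_mem_quasipolynomials _ _ one_pos) ?_
      have h := (quasipolynomials n).sum_mem (t := Finset.univ)
        (f := fun l => (φ (Pi.single l 1)) • fun γ : Fin n → ℂ => γ l) fun l _ =>
        (quasipolynomials n).smul_mem (Algebra.subset_adjoin (Or.inr ⟨l, rfl⟩)) _
      convert h using 1
      ext γ
      simp [Finset.sum_apply, Rat.smul_def]
    · have hz : z = ∑ l, z l • Pi.single (M := fun _ => ℤ) l 1 := by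
        ext j
        simp [Finset.sum_apply, Pi.single_apply]
      beta_reduce
      rw [basicQuasinumber_one_intCast, if_pos (fun l => by simp [Int.modEq_one])]
      conv_rhs => rw [hz]
      simp only [map_sum, map_zsmul]
      push_cast
      rw [one_mul]
      exact Finset.sum_congr rfl fun l _ => by simp [mul_comm]
    · simp [basicQuasinumber_eq_zero _ _ _ hγ]
  · rintro f ⟨d, hd, hf⟩
    let c (r : Fin n → Fin d) (l : Fin n) : ℤ := ((r l : ℕ) : ℤ)
    have hdZ : (0 : ℤ) < d := by exact_mod_cast hd
    refine ⟨fun γ => ∑ r : Fin n → Fin d, (f (c r) : ℂ) *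
      (basicQuasinumber (1 : Matrix (Fin n) (Fin n) ℤ) (c r) d γ : ℂ), ?_, fun z => ?_,
      fun γ hγ => ?_⟩
    · have h := (quasipolynomials n).sum_mem (t := (Finset.univ : Finset (Fin n → Fin d)))
        (f := fun r => (f (c r)) • fun γ : Fin n → ℂ =>
          ((basicQuasinumber (1 : Matrix (Fin n) (Fin n) ℤ) (c r) d γ : ℚ) : ℂ)) fun r _ =>
        (quasipolynomials n).smul_mem (basicQuasinumber_mem_quasipolynomials _ _ hd) _
      convert h using 1
      ext γ
      simp [Finset.sum_apply, Rat.smul_def]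
    · have hlt : ∀ l, (z l % d).toNat < d := fun l => by
        have := Int.emod_lt_of_pos (z l) hdZ
        omega
      have hmod : ∀ l, (((z l % d).toNat : ℕ) : ℤ) = z l % d := fun l =>
        Int.toNat_of_nonneg (Int.emod_nonneg _ hdZ.ne')
      simp only [basicQuasinumber_one_intCast]
      rw [Finset.sum_eq_single (fun l => ⟨(z l % d).toNat, hlt l⟩)]
      · rw [if_pos fun l => ?_]
        · rw [Rat.cast_one, mul_one, Rat.cast_inj, ← hf _ (fun l => z l / d)]
          congr 1
          ext l
          simp [c, hmod, Int.emod_add_mul_ediv]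
        · simp only [c, hmod]
          exact (Int.mod_modEq _ _).symm
      · intro r _ hr
        rw [if_neg, Rat.cast_zero, mul_zero]
        intro h
        apply hr
        ext l
        have h1 : z l % d = (r l : ℕ) % (d : ℤ) := h l
        rw [Int.emod_eq_of_lt (a := ((r l : ℕ) : ℤ)) (by omega) (by omega)] at h1
        simp [h1]
      · simp
    · simp [basicQuasinumber_eq_zero _ _ _ hγ]
  · rintro f g ⟨F, hF, h1, h2⟩ ⟨G, hG, h3, h4⟩
    exact ⟨F + G, (quasipolynomials n).add_mem hF hG, fun z => by simp [h1, h3],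
      fun γ hγ => by simp [h2 γ hγ, h4 γ hγ]⟩
  · rintro f g ⟨F, hF, h1, h2⟩ ⟨G, hG, h3, h4⟩
    exact ⟨F * G, (quasipolynomials n).mul_mem hF hG, fun z => by simp [h1, h3],
      fun γ hγ => by simp [h2 γ hγ, h4 γ hγ]⟩

open Filter Topology

/-! ### Cells of full dimension -/

section
variable {E : Type*} [AddCommGroup E] [Module ℚ E]

theorem eventually_add_smul_notMem {S : Submodule ℚ E} {x w : E} (h : x ∉ S ∨ w ∉ S) :
    ∀ᶠ t in 𝓝[>] (0 : ℚ), x + t • w ∉ S := by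
  have hsub : {t : ℚ | x + t • w ∈ S}.Subsingleton := by
    intro t ht t' ht'
    by_contra hne
    have hw : w ∈ S := by
      have h1 := S.sub_mem ht ht'
      rw [add_sub_add_left_eq_sub, ← sub_smul] at h1
      exact (S.smul_mem_iff (sub_ne_zero.mpr hne)).mp h1
    have hx : x ∈ S := (S.add_mem_iff_left (S.smul_mem t hw)).mp ht
    exact h.elim (· hx) (· hw)
  have h1 : {t : ℚ | x + t • w ∈ S} \ {0} ⊆ {t : ℚ | x + t • w ∈ S} := Set.sdiff_subset
  have hopen : IsOpen ({t : ℚ | x + t • w ∈ S} \ {0})ᶜ :=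
    (hsub.anti h1).finite.isClosed.isOpen_compl
  have hnhds := nhdsWithin_le_nhds (s := Set.Ioi (0 : ℚ)) (hopen.mem_nhds (x := 0) (by simp))
  filter_upwards [hnhds, self_mem_nhdsWithin] with t ht htpos hmem
  exact ht ⟨hmem, (Set.mem_Ioi.mp htpos).ne'⟩

theorem eventually_add_smul_notMem_polyCone {G : Set (Module.Dual ℚ E)} {x : E}
    (hx : x ∉ polyCone G) (w : E) : ∀ᶠ t in 𝓝[>] (0 : ℚ), x + t • w ∉ polyCone G := by
  have : ∃ h ∈ G, ¬ 0 ≤ h x := by simpa [polyCone] using hx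
  obtain ⟨h, hG, hneg⟩ := this
  have hcont : Continuous fun t : ℚ => h x + t * h w := by fun_prop
  have hev : ∀ᶠ t in 𝓝 (0 : ℚ), h x + t * h w < 0 :=
    hcont.continuousAt.eventually_lt continuousAt_const (by simpa using hneg)
  filter_upwards [nhdsWithin_le_nhds hev] with t ht hmem
  have := hmem h hG
  rw [map_add, map_smul, smul_eq_mul] at this
  exact absurd this (not_le.mpr ht)

/-- A cone contained in none of finitely many subspaces has a point outside all of them. -/
theorem exists_mem_forall_notMem {Λ : Set E} (hadd : ∀ x ∈ Λ, ∀ y ∈ Λ, x + y ∈ Λ)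
    (hsmul : ∀ t : ℚ, 0 ≤ t → ∀ x ∈ Λ, t • x ∈ Λ) (hne : Λ.Nonempty)
    {𝒮 : Set (Submodule ℚ E)} (h𝒮 : 𝒮.Finite) (h : ∀ S ∈ 𝒮, ¬ Λ ⊆ S) :
    ∃ w ∈ Λ, ∀ S ∈ 𝒮, w ∉ S := by
  induction 𝒮, h𝒮 using Set.Finite.induction_on with
  | empty => exact ⟨hne.some, hne.some_mem, by simp⟩
  | @insert S 𝒮 _ hfin ih =>
    obtain ⟨w, hw, hw𝒮⟩ := ih fun S hS => h S (Set.mem_insert_of_mem _ hS)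
    obtain ⟨u, hu, huS⟩ := Set.not_subset.mp (h S (Set.mem_insert _ _))
    have h1 : ∀ᶠ t in 𝓝[>] (0 : ℚ), ∀ S' ∈ 𝒮, w + t • u ∉ S' :=
      (eventually_all_finite hfin).mpr fun S' hS' => eventually_add_smul_notMem (Or.inl (hw𝒮 S' hS'))
    obtain ⟨t, ht, ht', htpos⟩ := (h1.and ((eventually_add_smul_notMem (x := w)
      (Or.inr huS)).and self_mem_nhdsWithin)).exists
    refine ⟨w + t • u, hadd _ hw _ (hsmul t (Set.mem_Ioi.mp htpos).le _ hu), ?_⟩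
    rintro S' (rfl | hS')
    exacts [ht', ht S' hS']

/-- If finitely many closed polyhedral cones cover a cone `Λ`, then those of full dimension
already do: a point `x` of `Λ` is approached from a generic direction `w` in `Λ`, along which
`x + t • w` avoids the cones of smaller dimension. -/
theorem exists_mem_span_eq {Λ : Set E} (hadd : ∀ x ∈ Λ, ∀ y ∈ Λ, x + y ∈ Λ)
    (hsmul : ∀ t : ℚ, 0 ≤ t → ∀ x ∈ Λ, t • x ∈ Λ) {𝒞 : Set (Set E)} (h𝒞 : 𝒞.Finite)
    (hpoly : ∀ C ∈ 𝒞, ∃ G, C = polyCone G) (hsub : ∀ C ∈ 𝒞, C ⊆ Λ)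
    (hcover : ∀ x ∈ Λ, ∃ C ∈ 𝒞, x ∈ C) {x : E} (hx : x ∈ Λ) :
    ∃ C ∈ 𝒞, x ∈ C ∧ Submodule.span ℚ C = Submodule.span ℚ Λ := by
  obtain ⟨w, hw, hgen⟩ := exists_mem_forall_notMem hadd hsmul ⟨x, hx⟩
    (𝒮 := Submodule.span ℚ '' {C ∈ 𝒞 | Submodule.span ℚ C ≠ Submodule.span ℚ Λ})
    ((h𝒞.subset (Set.sep_subset _ _)).image _) (by
      rintro _ ⟨C, ⟨hC, hne⟩, rfl⟩ hle
      exact hne (le_antisymm (Submodule.span_mono (hsub C hC)) (Submodule.span_le.mpr hle)))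
  by_contra! hcon
  have hev : ∀ᶠ t in 𝓝[>] (0 : ℚ), ∀ C ∈ 𝒞, x + t • w ∉ C := by
    refine (eventually_all_finite h𝒞).mpr fun C hC => ?_
    by_cases hspan : Submodule.span ℚ C = Submodule.span ℚ Λ
    · have hxC : x ∉ C := fun hxC => hcon C hC hxC hspan
      obtain ⟨G, rfl⟩ := hpoly C hC
      exact eventually_add_smul_notMem_polyCone hxC w
    · filter_upwards [eventually_add_smul_notMem (x := x)
        (Or.inr (hgen _ ⟨C, ⟨hC, hspan⟩, rfl⟩))] with t ht hmem
      exact ht (Submodule.subset_span hmem)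
  obtain ⟨t, ht, htpos⟩ := (hev.and self_mem_nhdsWithin).exists
  obtain ⟨C, hC, hmem⟩ := hcover _ (hadd _ hx _ (hsmul t (Set.mem_Ioi.mp htpos).le _ hw))
  exact ht C hC hmem

end

theorem dual_apply_eq_sum {n : ℕ} (h : Module.Dual ℚ (Fin n → ℚ)) (x : Fin n → ℚ) :
    h x = ∑ l, h (Pi.single l 1) * x l := by
  rw [LinearMap.pi_apply_eq_sum_univ h x]
  refine Finset.sum_congr rfl fun l _ => ?_
  rw [smul_eq_mul, mul_comm]
  congr 2
  ext j
  simp [Pi.single_apply, eq_comm]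

theorem isClosedPolyhedralCone_polyCone {n : ℕ} {G : Set (Module.Dual ℚ (Fin n → ℚ))}
    (hG : G.Finite) : IsClosedPolyhedralCone (polyCone G) := by
  have := hG.to_subtype
  obtain ⟨s, ⟨e⟩⟩ := Finite.exists_equiv_fin G
  refine ⟨s, Matrix.of fun r l => (e.symm r).1 (Pi.single l 1), ?_⟩
  ext x
  have hrow : ∀ r, (Matrix.of fun r l => (e.symm r).1 (Pi.single l 1)).mulVec x r =
      (e.symm r).1 x := fun r => (dual_apply_eq_sum _ x).symm
  simp only [Set.mem_ofPred_eq, hrow]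
  constructor
  · exact fun hx r => hx _ (e.symm r).2
  · intro hx h hh
    simpa using hx (e ⟨h, hh⟩)

/-- The real points all of whose coordinates with respect to a basis contained in the cone are
positive form a nonempty open set, and its rational points lie in the cone. -/
theorem hasNonzeroVolume_polyCone {n : ℕ} {G : Set (Module.Dual ℚ (Fin n → ℚ))}
    (hspan : Submodule.span ℚ (polyCone G) = ⊤) : HasNonzeroVolume (polyCone G) := by
  obtain ⟨I, _, b, hb⟩ : ∃ (I : Type) (_ : Finite I) (b : Module.Basis I ℚ (Fin n → ℚ)),
      ∀ i, b i ∈ polyCone G :=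
    ⟨_, Module.Finite.finite_basis (.ofSpan hspan.ge), .ofSpan hspan.ge,
      fun i => Module.Basis.ofSpan_subset hspan.ge (Set.mem_range_self i)⟩
  have := Fintype.ofFinite I
  let ι (x : Fin n → ℚ) (l : Fin n) : ℝ := x l
  let ℓ i (y : Fin n → ℝ) : ℝ := ∑ l, (b.coord i (Pi.single l 1) : ℝ) * y l
  have hℓ : ∀ i x, ℓ i (ι x) = b.coord i x := by
    intro i x
    rw [dual_apply_eq_sum]
    push_cast
    rfl
  let U : Set (Fin n → ℝ) := {y | ∀ i, 0 < ℓ i y}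
  have hU : IsOpen U := by
    have : U = ⋂ i, {y | 0 < ℓ i y} := by
      ext y
      simp [U]
    rw [this]
    exact isOpen_iInter_of_finite fun i => isOpen_lt continuous_const (by fun_prop)
  have hUne : U.Nonempty := by
    refine ⟨ι (∑ i, b i), fun i => ?_⟩
    rw [hℓ]
    simp
  have hdense : DenseRange ι := DenseRange.piMap fun _ => Rat.denseRange_cast
  have hsub : U ⊆ closure (ι '' polyCone G) := by
    refine (hdense.open_subset_closure_inter hU).trans (closure_mono ?_)
    rintro _ ⟨hy, x, rfl⟩
    refine ⟨x, fun h hh => ?_, rfl⟩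
    rw [← b.sum_repr x, map_sum]
    refine Finset.sum_nonneg fun i _ => ?_
    rw [map_smul, smul_eq_mul]
    have hpos := hy i
    rw [hℓ] at hpos
    exact mul_nonneg (by exact_mod_cast hpos.le) (hb i h hh)
  exact (hU.measure_pos _ hUne).trans_le (MeasureTheory.measure_mono hsub)

/-! ### Generators of the cone and rational points -/

theorem span_rationalCone {n N : ℕ} (α : Fin N → Fin n → ℤ) :
    Submodule.span ℚ (rationalCone α) = rationalSpan α := by
  apply le_antisymm
  · refine Submodule.span_le.mpr fun x hx => ?_
    obtain ⟨a, -, rfl⟩ := (mem_rationalCone_iff α x).mp hx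
    exact Submodule.sum_mem _ fun i _ =>
      Submodule.smul_mem _ _ (Submodule.subset_span ⟨i, rfl⟩)
  · refine Submodule.span_mono ?_
    rintro _ ⟨i, rfl⟩
    refine (mem_rationalCone_iff α _).mpr ⟨Pi.single i 1, fun j => ?_, ?_⟩
    · by_cases h : j = i
      · subst h
        simp
      · simp [h]
    · rw [Finset.sum_eq_single i (fun j _ h => by simp [h]) (by simp), Pi.single_eq_same, one_smul]
      rfl

theorem add_mem_rationalCone {n N : ℕ} {α : Fin N → Fin n → ℤ} {x y : Fin n → ℚ}
    (hx : x ∈ rationalCone α) (hy : y ∈ rationalCone α) : x + y ∈ rationalCone α := by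
  rw [mem_rationalCone_iff] at *
  obtain ⟨a, ha, rfl⟩ := hx
  obtain ⟨b, hb, rfl⟩ := hy
  exact ⟨a + b, fun i => add_nonneg (ha i) (hb i), by simp [add_smul, Finset.sum_add_distrib]⟩

theorem smul_mem_rationalCone {n N : ℕ} {α : Fin N → Fin n → ℤ} {t : ℚ} (ht : 0 ≤ t)
    {x : Fin n → ℚ} (hx : x ∈ rationalCone α) : t • x ∈ rationalCone α := by
  rw [mem_rationalCone_iff] at *
  obtain ⟨a, ha, rfl⟩ := hx
  exact ⟨t • a, fun i => mul_nonneg ht (ha i), by simp [Finset.smul_sum, mul_smul]⟩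

/-- A quasipolynomial on `ℤⁿ`, extended by zero, represents the vector partition function at all
rational points of a cone once it does so at the lattice points. -/
theorem exists_quasipolynomial_on {n N : ℕ} (α : Fin N → Fin n → ℤ) {C : Set (Fin n → ℚ)}
    {q : (Fin n → ℤ) → ℚ} (hq : q ∈ quasi (Fin n → ℤ))
    (h : ∀ z, toRat n z ∈ C → partitionCount α z = q z) :
    ∃ Q ∈ quasipolynomials n, ∀ γ ∈ C,
      (vectorPartition α (fun l => (γ l : ℂ)) : ℂ) = Q (fun l => (γ l : ℂ)) := by
  obtain ⟨Q, hQ, hint, hzero⟩ := exists_quasipolynomial_extension hq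
  refine ⟨Q, hQ, fun γ hγ => ?_⟩
  by_cases hz : ∃ z : Fin n → ℤ, ∀ l, (γ l : ℂ) = z l
  · obtain ⟨z, hz⟩ := hz
    obtain rfl : γ = toRat n z := by
      ext l
      exact_mod_cast hz l
    have hcast : (fun l => ((toRat n z l : ℚ) : ℂ)) = fun l => (z l : ℂ) := by
      ext l
      simp
    rw [hcast, vectorPartition_intCast, hint, h z hγ]
  · rw [hzero _ hz, vectorPartition_eq_zero α hz, Int.cast_zero]

end VectorPartition

/-! ### Piecewise quasipolynomiality -/

/-- The cones `C j` are full-dimensional in the span of the `α i`; if this span is all of `ℚⁿ`,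
they are closed pointed polyhedral cones, of non-zero `n`-volume. -/
theorem mainTheorem1 (n N : ℕ) (α : Fin N → Fin n → ℤ)
    (hα_nonneg : ∀ i l, 0 ≤ α i l) (hα_ne : ∀ i, α i ≠ 0) :
    ∃ (M : ℕ) (C : Fin M → Set (Fin n → ℚ)) (q : Fin M → (Fin n → ℂ) → ℂ),
      (∀ j, IsClosedPolyhedralCone (C j) ∧ Submodule.span ℚ (C j) = rationalSpan α) ∧
      (rationalSpan α = ⊤ → ∀ j, IsClosedPointedPolyhedralCone (C j)) ∧
      (⋃ j, C j) = rationalCone α ∧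
      (∀ j, q j ∈ quasipolynomials n) ∧
      (∀ j, ∀ γ ∈ C j, (vectorPartition α (fun l => (γ l : ℂ)) : ℂ) = q j (fun l => (γ l : ℂ))) ∧
      (∀ i j, ∀ γ ∈ C i ∩ C j, q i (fun l => (γ l : ℂ)) = q j (fun l => (γ l : ℂ))) := by
  open VectorPartition in
  obtain ⟨H, hH, ⟨G, hGH, hG⟩, hquasi⟩ := isPiecewiseQuasi_partitionCount α hα_nonneg hα_ne
  let 𝒞 : Set (Set (Fin n → ℚ)) := cell H '' rationalCone α
  have h𝒞 : 𝒞.Finite := (finite_cells hH).subset (Set.image_subset_range _ _)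
  have hsub : ∀ C ∈ 𝒞, C ⊆ rationalCone α := by
    rintro _ ⟨x, hx, rfl⟩
    rw [hG] at hx ⊢
    exact cell_subset_polyCone hGH hx
  let 𝒟 : Set (Set (Fin n → ℚ)) := {C ∈ 𝒞 | Submodule.span ℚ C = rationalSpan α}
  have := (h𝒞.subset (Set.sep_subset _ _) : 𝒟.Finite).to_subtype
  obtain ⟨M, ⟨e⟩⟩ := Finite.exists_equiv_fin 𝒟
  let C (j : Fin M) : Set (Fin n → ℚ) := (e.symm j).1
  have hC : ∀ j, ∃ x ∈ rationalCone α, cell H x = C j := fun j => (e.symm j).2.1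
  have hspan : ∀ j, Submodule.span ℚ (C j) = rationalSpan α := fun j => (e.symm j).2.2
  have hclosed : ∀ j, IsClosedPolyhedralCone (C j) := by
    intro j
    obtain ⟨x, -, hx⟩ := hC j
    rw [← hx]
    exact isClosedPolyhedralCone_polyCone (hH.subset (Set.sep_subset _ _))
  have hQ : ∀ j, ∃ Q ∈ quasipolynomials n, ∀ γ ∈ C j,
      (vectorPartition α (fun l => (γ l : ℂ)) : ℂ) = Q (fun l => (γ l : ℂ)) := by
    intro j
    obtain ⟨x, hx, hxC⟩ := hC j
    obtain ⟨q, hq, hqx⟩ := hquasi x hx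
    exact exists_quasipolynomial_on α hq fun z hz => hqx z (hxC ▸ hz)
  choose q hq hqC using hQ
  refine ⟨M, C, q, fun j => ⟨hclosed j, hspan j⟩, fun htop j => ⟨hclosed j, ?_⟩, ?_, hq, hqC,
    fun i j γ hγ => (hqC i γ hγ.1).symm.trans (hqC j γ hγ.2)⟩
  · have hj := (hspan j).trans htop
    obtain ⟨x, -, hx⟩ := hC j
    rw [← hx] at hj ⊢
    exact hasNonzeroVolume_polyCone hj
  · refine Set.Subset.antisymm (Set.iUnion_subset fun j => hsub _ (e.symm j).2.1) fun x hx => ?_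
    obtain ⟨D, hD, hxD, hDspan⟩ := exists_mem_span_eq (fun _ h _ h' => add_mem_rationalCone h h')
      (fun t ht _ h => smul_mem_rationalCone ht h) h𝒞
      (by rintro _ ⟨y, -, rfl⟩; exact ⟨_, rfl⟩) hsub
      (fun y hy => ⟨cell H y, ⟨y, hy, rfl⟩, mem_cell_self H y⟩) hx
    rw [span_rationalCone] at hDspan
    exact Set.mem_iUnion.mpr ⟨e ⟨D, hD, hDspan⟩, by simpa [C] using hxD⟩
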